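/- Let $K$ be a field, $G$ a group, and let $A$ and $B$ be unital associative $K$-algebras. Let $\alpha$ be a partial action of $G$ on $A$, i.e. a family of (two-sided) ideals $D_g$ of $A$ and $K$-algebra isomorphisms $\alpha_g : D_{g^{-1}}\to D_g$ $(g\in G)$ such that $D_1=A$, $\alpha_1=\mathrm{id}_A$, $\alpha_h^{-1}(D_h\cap D_{g^{-1}})\subseteq D_{(gh)^{-1}}$, and $\alpha_g(\alpha_h(x))=\alpha_{gh}(x)$ for all $x\in\alpha_h^{-1}(D_h\cap D_{g^{-1}})$. Let $\beta$ be an action of $G$ on $B$ by $K$-algebra automorphisms which is an enveloping action for $\alpha$: there is an injective (not necessarily unital) $K$-algebra homomorphism $\varphi:A\to B$ whose image is an ideal of $B$, such that $\varphi(D_g)=\varphi(A)\cap\beta_g(\varphi(A))$ and $\varphi(\alpha_g(x))=\beta_g(\varphi(x))$ for all $g\in G$, $x\in D_{g^{-1}}$, and such that $B$ is generated, as a not necessarily unital algebra, by $\bigcup_{g\in G}\beta_g(\varphi(A))$. Fix such a $\varphi$. Let $A\rtimes_\alpha G$ be the skew group ring of finite formal sums $\sum_g a_g\delta_g$ with $a_g\in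 D_g$ and product $(a\delta_g)(b\delta_h)=\alpha_g(\alpha_{g^{-1}}(a)b)\delta_{gh}$; it is associative with unity $1_A\delta_1$, and is viewed inside the skew group ring $B\rtimes_\beta G$ (with product $(b\delta_g)(c\delta_h)=b\beta_g(c)\delta_{gh}$) via $a\delta_g\mapsto\varphi(a)\delta_g$. Then $A\rtimes_\alpha G$ and $B\rtimes_\beta G$ are Morita equivalent: there is a $K$-linear equivalence between their categories of left modules. Moreover, put $$M=\Big\{\sum_g c_g\delta_g : c_g\in\varphi(A)\Big\},\qquad N=\Big\{\sum_g c_g\delta_g : c_g\in\beta_g(\varphi(A))\Big\}\subseteq B\rtimes_\beta G .$$ With the actions given by multiplication in $B\rtimes_\beta G$, $M$ is an $(A\rtimes_\alpha G)$-$(B\rtimes_\beta G)$-bimodule and $N$ is a $(B\rtimes_\beta G)$-$(A\rtimes_\alpha G)$-bimodule. The assignments $m\otimes n\mapsto mn$ and $n\otimes m\mapsto nm$ define bimodule maps $$\tau: M\otimes_{B\rtimes_\beta G}N\to A\rtimes_\alpha G,\qquad \tau': N\otimes_{A\rtimes_\alpha G}M\to B\rtimes_\beta G,$$ and $(A\rtimes_\alpha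 G,\,B\rtimes_\beta G,\,M,\,N,\,\tau,\,\tau')$ is a Morita context (that is, $\tau(m\otimes n)m'=m\,\tau'(n\otimes m')$ and $\tau'(n\otimes m)n'=n\,\tau(m\otimes n')$ for all $m,m'\in M$, $n,n'\in N$) in which $\tau$ and $\tau'$ are both surjective. -/

import Mathlib

open scoped TensorProduct DirectSum

universe u v w u₁ u₂

/-! ### Partial actions on algebras -/

/-- A partial action of a group `G` on an associative, not necessarily unital, `K`-algebra `A`:
ideals `D g` of `A` and algebra isomorphisms `α g : D g⁻¹ → D g` such that
(i) `D 1 = A` and `α 1` is the identity,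
(ii) `α h ⁻¹ (D h ∩ D g⁻¹) ⊆ D (g h)⁻¹`,
(iii) `α g (α h x) = α (g h) x` for every `x ∈ α h ⁻¹ (D h ∩ D g⁻¹)`. -/
structure AlgPartialAction (K : Type*) (G : Type*) (A : Type*) [Field K] [Group G]
    [NonUnitalRing A] [Module K A] where
  D : G → Submodule K A
  mul_mem_left : ∀ (g : G) (a : A) {x : A}, x ∈ D g → a * x ∈ D g
  mul_mem_right : ∀ (g : G) {x : A} (a : A), x ∈ D g → x * a ∈ D g
  α : ∀ g : G, D g⁻¹ ≃ₗ[K] D g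
  map_mul : ∀ (g : G) (x y : D g⁻¹),
    (α g ⟨(x : A) * y, mul_mem_left g⁻¹ x y.2⟩ : A) = (α g x : A) * α g y
  D_one : D 1 = ⊤
  map_one : ∀ x : D (1 : G)⁻¹, (α 1 x : A) = x
  mem_D_mul_inv : ∀ (g h : G) (x : D h⁻¹), (α h x : A) ∈ D g⁻¹ → (x : A) ∈ D (g * h)⁻¹
  map_map : ∀ (g h : G) (x : D h⁻¹) (hx : (α h x : A) ∈ D g⁻¹),
    (α g ⟨α h x, hx⟩ : A) = α (g * h) ⟨x, mem_D_mul_inv g h x hx⟩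

namespace AlgPartialAction

section NonUnital

variable {K G A : Type*} [Field K] [Group G] [NonUnitalRing A] [Module K A]
  (α : AlgPartialAction K G A)

theorem α_congr {g h : G} (e : g = h) (x : α.D g⁻¹) (y : α.D h⁻¹) (hxy : (x : A) = y) :
    (α.α g x : A) = α.α h y := by
  subst e
  rw [Subtype.ext hxy]

theorem α_add (g : G) (x y z : α.D g⁻¹) (hz : (z : A) = x + y) :
    (α.α g z : A) = α.α g x + α.α g y := by
  rw [show z = x + y from Subtype.ext hz, _root_.map_add, Submodule.coe_add]

theorem α_smul (g : G) (c : K) (x z : α.D g⁻¹) (hz : (z : A) = c • (x : A)) :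
    (α.α g z : A) = c • (α.α g x : A) := by
  rw [show z = c • x from Subtype.ext hz, _root_.map_smul, Submodule.coe_smul]

/-- `α g⁻¹` is the inverse map of `α g`. -/
theorem α_inv_apply (g : G) (a : α.D g) (ha : (a : A) ∈ α.D g⁻¹⁻¹) :
    (α.α g⁻¹ ⟨a, ha⟩ : A) = (α.α g).symm a := by
  have h0 : ((α.α g ((α.α g).symm a) : α.D g) : A) ∈ α.D g⁻¹⁻¹ := by simpa using ha
  have h1 := α.map_map g⁻¹ g ((α.α g).symm a) h0
  have h2 : (α.α g⁻¹ ⟨a, ha⟩ : A) = α.α g⁻¹ ⟨α.α g ((α.α g).symm a), h0⟩ :=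
    α.α_congr rfl _ _ (by simp)
  have h3 : (((α.α g).symm a : α.D g⁻¹) : A) ∈ α.D (1 : G)⁻¹ := by
    rw [inv_one, α.D_one]; trivial
  rw [h2, h1, α.α_congr (inv_mul_cancel g) _ ⟨_, h3⟩ rfl, α.map_one]

theorem α_symm_mul_mem (g h : G) (a : α.D g) (b : α.D h) :
    (α.α g ⟨((α.α g).symm a : A) * b, α.mul_mem_right _ _ ((α.α g).symm a).2⟩ : A)
      ∈ α.D (g * h) := by
  set y : α.D g⁻¹ := ⟨((α.α g).symm a : A) * b, α.mul_mem_right _ _ ((α.α g).symm a).2⟩ with hy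
  have hz : ((α.α g y : α.D g) : A) ∈ α.D g⁻¹⁻¹ := by rw [inv_inv]; exact (α.α g y).2
  have h1 : (α.α g⁻¹ ⟨α.α g y, hz⟩ : A) = y := by
    rw [α.α_inv_apply g (α.α g y) hz, LinearEquiv.symm_apply_apply]
  have h2 := α.mem_D_mul_inv h⁻¹ g⁻¹ ⟨α.α g y, hz⟩ (by
    rw [h1, inv_inv]; exact α.mul_mem_left _ _ b.2)
  simpa [mul_inv_rev] using h2

/-! ### The skew group ring of a partial action -/

/-- The coefficient `α g (α g⁻¹ (a) * b) ∈ D (g h)` of the product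
`(a δ_g) (b δ_h)`, for `a ∈ D g` and `b ∈ D h`. -/
def mulCoeff (g h : G) (a : α.D g) (b : α.D h) : α.D (g * h) :=
  ⟨α.α g ⟨((α.α g).symm a : A) * b, α.mul_mem_right _ _ ((α.α g).symm a).2⟩,
    α.α_symm_mul_mem g h a b⟩

/-- The underlying vector space of the skew group ring `A ⋊_α G`: finite formal sums
`∑ a_g δ_g` with `a_g ∈ D g`. -/
def SkewGroupRing (α : AlgPartialAction K G A) : Type _ := ⨁ g : G, α.D g

noncomputable instance : AddCommGroup α.SkewGroupRing :=
  inferInstanceAs (AddCommGroup (⨁ g : G, α.D g))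

noncomputable instance : Module K α.SkewGroupRing :=
  inferInstanceAs (Module K (⨁ g : G, α.D g))

open scoped Classical in
/-- `δ g a` is the formal sum `a δ_g` with a single term. -/
noncomputable def δ (g : G) : α.D g →ₗ[K] α.SkewGroupRing :=
  DirectSum.lof K G (fun g => α.D g) g

open scoped Classical in
/-- The linear map on `A ⋊_α G` that is `f g` on the `g`-component. -/
noncomputable def liftLinear {N : Type*} [AddCommGroup N] [Module K N]
    (f : ∀ g : G, α.D g →ₗ[K] N) : α.SkewGroupRing →ₗ[K] N :=
  DirectSum.toModule K G N f

theorem liftLinear_δ {N : Type*} [AddCommGroup N] [Module K N]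
    (f : ∀ g : G, α.D g →ₗ[K] N) (g : G) (a : α.D g) : α.liftLinear f (α.δ g a) = f g a := by
  classical
  exact DirectSum.toModule_lof (M := fun g => α.D g) K g a

theorem linearMap_ext {N : Type*} [AddCommGroup N] [Module K N]
    {f f' : α.SkewGroupRing →ₗ[K] N} (h : ∀ g a, f (α.δ g a) = f' (α.δ g a)) : f = f' := by
  classical
  exact DirectSum.linearMap_ext K fun g => LinearMap.ext (h g)

theorem induction_on {p : α.SkewGroupRing → Prop} (x : α.SkewGroupRing) (zero : p 0)
    (single : ∀ g a, p (α.δ g a)) (add : ∀ x y, p x → p y → p (x + y)) : p x := by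
  classical
  exact DirectSum.induction_on (motive := p) x zero single add

variable [IsScalarTower K A A] [SMulCommClass K A A]

/-- `mulCoeff` as a bilinear map, followed by `δ (g h)`. -/
noncomputable def mulδ (g h : G) : α.D g →ₗ[K] α.D h →ₗ[K] α.SkewGroupRing :=
  LinearMap.mk₂ K (fun a b => α.δ (g * h) (α.mulCoeff g h a b))
    (fun a a' b => by
      rw [← _root_.map_add]
      exact congrArg _ (Subtype.ext (α.α_add g _ _ _ (by simp [add_mul]))))
    (fun c a b => by
      rw [← _root_.map_smul]
      exact congrArg _ (Subtype.ext (α.α_smul g c _ _ (by simp [smul_mul_assoc]))))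
    (fun a b b' => by
      rw [← _root_.map_add]
      exact congrArg _ (Subtype.ext (α.α_add g _ _ _ (by simp [mul_add]))))
    (fun c a b => by
      rw [← _root_.map_smul]
      exact congrArg _ (Subtype.ext (α.α_smul g c _ _ (by simp [mul_smul_comm]))))

/-- The multiplication of `A ⋊_α G`, as a bilinear map. -/
noncomputable def mulₗ : α.SkewGroupRing →ₗ[K] α.SkewGroupRing →ₗ[K] α.SkewGroupRing :=
  α.liftLinear fun g => LinearMap.flip (α.liftLinear fun h => LinearMap.flip (α.mulδ g h))

/-- The skew group ring `A ⋊_α G`, in general not associative, with the product determined by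
`(a δ_g) (b δ_h) = α g (α g⁻¹ (a) b) δ_{g h}`. -/
noncomputable instance : NonUnitalNonAssocRing α.SkewGroupRing where
  mul x y := α.mulₗ x y
  left_distrib x y z := (α.mulₗ x).map_add y z
  right_distrib x y z := α.mulₗ.map_add₂ x y z
  zero_mul x := α.mulₗ.map_zero₂ x
  mul_zero x := (α.mulₗ x).map_zero

theorem mul_eq (x y : α.SkewGroupRing) : x * y = α.mulₗ x y := rfl

theorem δ_mul_δ (g h : G) (a : α.D g) (b : α.D h) :
    α.δ g a * α.δ h b = α.δ (g * h) (α.mulCoeff g h a b) := by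
  rw [mul_eq, mulₗ, liftLinear_δ, LinearMap.flip_apply, liftLinear_δ]
  rfl

/-- The skew group ring `A ⋊_α G` is associative. -/
class IsAssociative : Prop where
  mul_assoc : ∀ x y z : α.SkewGroupRing, x * y * z = x * (y * z)

end NonUnital

section Unital

variable {K G A : Type*} [Field K] [Group G] [Ring A] [Algebra K A]
  (α : AlgPartialAction K G A)

theorem δ_congr {g h : G} (e : g = h) (a : α.D g) (b : α.D h) (hab : (a : A) = b) :
    α.δ g a = α.δ h b := by
  subst e
  rw [Subtype.ext hab]

/-- The unity element `1_A δ_1` of `A ⋊_α G`. -/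
noncomputable instance : One α.SkewGroupRing where
  one := α.δ 1 ⟨1, by rw [α.D_one]; trivial⟩

theorem one_eq : (1 : α.SkewGroupRing) = α.δ 1 ⟨1, by rw [α.D_one]; trivial⟩ := rfl

theorem skew_one_mul (x : α.SkewGroupRing) : 1 * x = x := by
  suffices h : α.mulₗ 1 = LinearMap.id from LinearMap.congr_fun h x
  refine α.linearMap_ext fun g a => ?_
  rw [← mul_eq, one_eq, δ_mul_δ]
  refine α.δ_congr (one_mul g) _ _ ?_
  simp only [mulCoeff]
  rw [α.map_one]
  have : (((α.α 1).symm ⟨1, by rw [α.D_one]; trivial⟩ : α.D (1 : G)⁻¹) : A) = 1 := by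
    rw [← α.map_one, LinearEquiv.apply_symm_apply]
  simp [this]

theorem skew_mul_one (x : α.SkewGroupRing) : x * 1 = x := by
  suffices h : α.mulₗ.flip 1 = LinearMap.id from LinearMap.congr_fun h x
  refine α.linearMap_ext fun g a => ?_
  rw [LinearMap.flip_apply, ← mul_eq, one_eq, δ_mul_δ]
  refine α.δ_congr (mul_one g) _ _ ?_
  simp only [mulCoeff, mul_one, Subtype.coe_eta, LinearEquiv.apply_symm_apply]

/-- `A ⋊_α G` is a ring as soon as it is associative. -/
noncomputable instance [α.IsAssociative] : Ring α.SkewGroupRing where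
  __ := (inferInstance : NonUnitalNonAssocRing α.SkewGroupRing)
  mul_assoc := IsAssociative.mul_assoc
  one_mul := α.skew_one_mul
  mul_one := α.skew_mul_one

noncomputable instance [α.IsAssociative] : Algebra K α.SkewGroupRing :=
  Algebra.ofModule (fun c x y => α.mulₗ.map_smul₂ c x y) (fun c x y => (α.mulₗ x).map_smul c y)

/-! ### Enveloping actions -/

variable {B : Type*} [Ring B] [Algebra K B] [MulSemiringAction G B]

/-- The action of `G` on `B` is an enveloping action for the partial action `α` of `G` on `A`,
the equivalence of `α` with an admissible restriction being given by `φ : A → B`.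
Algebras being not necessarily unital, "generated" refers to non-unital subalgebras. -/
structure IsEnveloping (φ : A →ₙₐ[K] B) : Prop where
  injective : Function.Injective φ
  mul_mem_left : ∀ (b : B) (a : A), b * φ a ∈ Set.range φ
  mul_mem_right : ∀ (a : A) (b : B), φ a * b ∈ Set.range φ
  image_D : ∀ g : G, φ '' (α.D g : Set A) = Set.range φ ∩ (fun b : B => g • b) '' Set.range φ
  map_α : ∀ (g : G) (x : α.D g⁻¹), φ (α.α g x) = g • φ x
  generates : NonUnitalAlgebra.adjoin K (⋃ g : G, (fun b : B => g • b) '' Set.range φ) = ⊤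

/-- The map `A ⋊_α G → B ⋊_β G` sending `a δ_g` to `φ(a) δ_g`. Here `B ⋊_β G` is
`SkewMonoidAlgebra B G`, in which `(b δ_g) (c δ_h) = b β_g(c) δ_{g h}`. -/
noncomputable def toGlobal (φ : A →ₙₐ[K] B) : α.SkewGroupRing →ₗ[K] SkewMonoidAlgebra B G :=
  α.liftLinear fun g =>
    (SkewMonoidAlgebra.lsingle K g).comp ((φ : A →ₗ[K] B).comp (α.D g).subtype)

theorem toGlobal_δ (φ : A →ₙₐ[K] B) (g : G) (a : α.D g) :
    α.toGlobal φ (α.δ g a) = SkewMonoidAlgebra.single g (φ a) := by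
  rw [toGlobal, liftLinear_δ]
  rfl

open scoped Classical in
theorem coeff_toGlobal (φ : A →ₙₐ[K] B) (x : α.SkewGroupRing) (g : G) :
    (α.toGlobal φ x).coeff g = φ (DirectSum.component K G (fun g => α.D g) g x) := by
  suffices h : ((Finsupp.lapply g).comp
      (SkewMonoidAlgebra.coeffLinearEquiv (S := K) (k := B) (G := G)).toLinearMap).comp
        (α.toGlobal φ) =
      ((φ : A →ₗ[K] B).comp (α.D g).subtype).comp (DirectSum.component K G (fun g => α.D g) g) from
    LinearMap.congr_fun h x
  refine α.linearMap_ext fun h a => ?_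
  simp only [LinearMap.comp_apply, toGlobal_δ]
  change (SkewMonoidAlgebra.single h (φ a)).coeff g =
    φ ((DirectSum.component K G (fun g => α.D g) g (DirectSum.lof K G _ h a) : α.D g) : A)
  rw [SkewMonoidAlgebra.coeff_single_apply]
  split_ifs with e
  · subst e
    rw [DirectSum.component.lof_self]
  · rw [DirectSum.component.of, dif_neg e]
    simp

variable {α} {φ : A →ₙₐ[K] B}

theorem IsEnveloping.toGlobal_injective (h : α.IsEnveloping φ) :
    Function.Injective (α.toGlobal φ) := by
  classical
  intro x y hxy
  refine DirectSum.ext_component K fun g => ?_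
  apply Subtype.ext
  apply h.injective
  rw [← coeff_toGlobal, ← coeff_toGlobal, hxy]

theorem IsEnveloping.toGlobal_mul (h : α.IsEnveloping φ) (x y : α.SkewGroupRing) :
    α.toGlobal φ (x * y) = α.toGlobal φ x * α.toGlobal φ y := by
  induction x using α.induction_on with
  | zero => rw [zero_mul, _root_.map_zero, zero_mul]
  | add x x' hx hx' => rw [add_mul, _root_.map_add, _root_.map_add, add_mul, hx, hx']
  | single g a =>
    induction y using α.induction_on with
    | zero => rw [mul_zero, _root_.map_zero, mul_zero]
    | add y y' hy hy' => rw [mul_add, _root_.map_add, _root_.map_add, mul_add, hy, hy']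
    | single k b =>
      rw [δ_mul_δ, toGlobal_δ, toGlobal_δ, toGlobal_δ, SkewMonoidAlgebra.single_mul_single]
      congr 1
      simp only [mulCoeff]
      rw [h.map_α, _root_.map_mul, smul_mul', ← h.map_α, LinearEquiv.apply_symm_apply]

/-- If `α` has an enveloping action, then `A ⋊_α G` is associative. -/
theorem IsEnveloping.isAssociative (h : α.IsEnveloping φ) : α.IsAssociative where
  mul_assoc x y z := h.toGlobal_injective (by simp only [h.toGlobal_mul, mul_assoc])

end Unital

section Bimodules

variable {K : Type*} (G : Type*) {A B : Type*} [Field K] [Group G] [Ring A] [Algebra K A]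
  [Ring B] [Algebra K B] [MulSemiringAction G B]

/-- The subspace `M = {∑ c_g δ_g : c_g ∈ φ(A)}` of `B ⋊_β G`. -/
def envM (φ : A →ₙₐ[K] B) : Submodule K (SkewMonoidAlgebra B G) where
  carrier := {x | ∀ g : G, x.coeff g ∈ Set.range φ}
  zero_mem' g := ⟨0, by simp⟩
  add_mem' {x y} hx hy g := by
    obtain ⟨a, ha⟩ := hx g
    obtain ⟨b, hb⟩ := hy g
    exact ⟨a + b, by simp [ha, hb]⟩
  smul_mem' c x hx g := by
    obtain ⟨a, ha⟩ := hx g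
    exact ⟨c • a, by simp [ha]⟩

/-- The subspace `N = {∑ c_g δ_g : c_g ∈ β_g(φ(A))}` of `B ⋊_β G`. -/
def envN [SMulCommClass G K B] (φ : A →ₙₐ[K] B) : Submodule K (SkewMonoidAlgebra B G) where
  carrier := {x | ∀ g : G, x.coeff g ∈ (fun b : B => g • b) '' Set.range φ}
  zero_mem' g := ⟨0, ⟨0, by simp⟩, by simp⟩
  add_mem' {x y} hx hy g := by
    obtain ⟨_, ⟨a, rfl⟩, ha⟩ := hx g
    obtain ⟨_, ⟨b, rfl⟩, hb⟩ := hy g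
    exact ⟨φ (a + b), ⟨_, rfl⟩, by simpa using congrArg₂ (· + ·) ha hb⟩
  smul_mem' c x hx g := by
    obtain ⟨_, ⟨a, rfl⟩, ha⟩ := hx g
    exact ⟨φ (c • a), ⟨_, rfl⟩, by simpa [smul_comm g c] using congrArg (c • ·) ha⟩

end Bimodules

end AlgPartialAction

/-! ### Morita contexts -/

/-- The tensor product `M ⊗_R M'` of a right `R`-module `M` and a left `R`-module `M'` over a not
necessarily commutative ring `R`: the quotient of `M ⊗_ℤ M'` by the subgroup generated by the
elements `m r ⊗ m' - m ⊗ r m'`. -/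
def BalancedTensor (R : Type*) (M : Type*) (M' : Type*) [Ring R] [AddCommGroup M]
    [AddCommGroup M'] [Module Rᵐᵒᵖ M] [Module R M'] : Type _ :=
  (M ⊗[ℤ] M') ⧸ AddSubgroup.closure
    {z : M ⊗[ℤ] M' | ∃ (m : M) (r : R) (m' : M'),
      z = (MulOpposite.op r • m) ⊗ₜ[ℤ] m' - m ⊗ₜ[ℤ] (r • m')}

namespace BalancedTensor

variable (R : Type*) {M : Type*} {M' : Type*} [Ring R] [AddCommGroup M]
    [AddCommGroup M'] [Module Rᵐᵒᵖ M] [Module R M']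

noncomputable instance : AddCommGroup (BalancedTensor R M M') :=
  inferInstanceAs (AddCommGroup ((M ⊗[ℤ] M') ⧸ AddSubgroup.closure _))

/-- The class `m ⊗ m'` of a pure tensor. -/
def tmul (m : M) (m' : M') : BalancedTensor R M M' :=
  QuotientAddGroup.mk (m ⊗ₜ[ℤ] m')

end BalancedTensor

/-- A Morita context `(R, R', M, M', τ, τ')`: an `R`-`R'`-bimodule `M`, an `R'`-`R`-bimodule `M'`,
and bimodule maps `τ : M ⊗_{R'} M' → R` and `τ' : M' ⊗_R M → R'` with
`τ(x ⊗ x') y = x τ'(x' ⊗ y)` and `τ'(x' ⊗ x) y' = x' τ(x ⊗ y')`.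
The bimodule conditions on the additive maps `τ` and `τ'` are stated on the generating pure
tensors, where the actions are `r (x ⊗ x') = (r x) ⊗ x'` and `(x ⊗ x') r = x ⊗ (x' r)`. -/
structure MoritaContext (R : Type u₁) (R' : Type u₂) [Ring R] [Ring R'] where
  M : Type u
  M' : Type v
  [addCommGroupM : AddCommGroup M]
  [addCommGroupM' : AddCommGroup M']
  [leftM : Module R M]
  [rightM : Module R'ᵐᵒᵖ M]
  [bimoduleM : SMulCommClass R R'ᵐᵒᵖ M]
  [leftM' : Module R' M']
  [rightM' : Module Rᵐᵒᵖ M']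
  [bimoduleM' : SMulCommClass R' Rᵐᵒᵖ M']
  τ : BalancedTensor R' M M' →+ R
  τ' : BalancedTensor R M' M →+ R'
  τ_left : ∀ (r : R) (x : M) (x' : M'), τ (.tmul R' (r • x) x') = r * τ (.tmul R' x x')
  τ_right : ∀ (r : R) (x : M) (x' : M'),
    τ (.tmul R' x (MulOpposite.op r • x')) = τ (.tmul R' x x') * r
  τ'_left : ∀ (s : R') (x' : M') (x : M), τ' (.tmul R (s • x') x) = s * τ' (.tmul R x' x)
  τ'_right : ∀ (s : R') (x' : M') (x : M),
    τ' (.tmul R x' (MulOpposite.op s • x)) = τ' (.tmul R x' x) * s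
  τ_smul : ∀ (x : M) (x' : M') (y : M),
    τ (.tmul R' x x') • y = MulOpposite.op (τ' (.tmul R x' y)) • x
  τ'_smul : ∀ (x' : M') (x : M) (y' : M'),
    τ' (.tmul R x' x) • y' = MulOpposite.op (τ (.tmul R' x y')) • x'

attribute [instance] MoritaContext.addCommGroupM MoritaContext.addCommGroupM'
  MoritaContext.leftM MoritaContext.rightM MoritaContext.bimoduleM
  MoritaContext.leftM' MoritaContext.rightM' MoritaContext.bimoduleM'

/-! Write `S` for `B ⋊_β G`, `R` for `A ⋊_α G`, and `e = φ(1_A) δ_1`, an idempotent of `S`.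
Everything follows from the fact that `R` is the corner `e S e` and that `e` is full, i.e. `S e S =
S`.

Corner: `φ(1_A)` is the identity of the ideal `φ(A)`, so the coefficient `φ(1_A) b β_g(φ(1_A))` of
`e (b δ_g) e` lies in `φ(A) ∩ β_g(φ(A)) = φ(D_g)` (`exists_toGlobal_eq`). In the same way `M = e S`
and `N = S e` (`mem_envM_iff`, `mem_envN_iff`). Fullness: `S e S` contains `β_g(φ(a)) δ_1` for all
`g` and `a`; these coefficients generate `B`, so `1_B δ_1` is in `S e S` (`span_toGlobal_one_mul`).

The rest is Morita theory of a full idempotent. Fullness gives `1 = ∑ s e t`, so an `S`-module `X`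
is generated by `e X`, and `X ↦ e X` is fully faithful; it is essentially surjective because `e
Hom_R(e S, Y) ≃ Y`. Multiplication `e S × S e → e S e` and `S e × e S → S` is the Morita context;
the first map is onto since `e` is the identity of `e S e`, the second by fullness. -/

/-- A homomorphism of `K`-algebras, not necessarily unital, that identifies `R` with the corner
`e S e` of `S` at the full idempotent `e = ι 1`. -/
structure IsFullCorner {K R S : Type*} [CommRing K] [Ring R] [Ring S] [Algebra K R] [Algebra K S]
    (ι : R →ₙₐ[K] S) : Prop where
  injective : Function.Injective ι
  exists_eq : ∀ s : S, ∃ r : R, ι r = ι 1 * s * ι 1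
  full : Ideal.span (Set.range fun t : S => ι 1 * t) = ⊤

/-! ### Modules attached to an idempotent: `e X`, `e S`, `S e` and coinduction -/

namespace IsFullCorner

section Fixed

variable {K R S : Type*} [CommRing K] [Ring R] [Ring S] [Algebra K R] [Algebra K S]
  (ι : R →ₙₐ[K] S)

theorem one_mul_map (r : R) : ι 1 * ι r = ι r := by rw [← map_mul, one_mul]

theorem map_mul_one (r : R) : ι r * ι 1 = ι r := by rw [← map_mul, mul_one]

/-- The subgroup `e X` of an `S`-module `X`, where `e = ι 1`. -/
def fixed (X : Type*) [AddCommGroup X] [Module S X] : AddSubgroup X where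
  carrier := {x | ι 1 • x = x}
  zero_mem' := smul_zero _
  add_mem' {x y} hx hy := by
    change ι 1 • (x + y) = x + y
    rw [smul_add, show ι 1 • x = x from hx, show ι 1 • y = y from hy]
  neg_mem' {x} hx := by
    change ι 1 • -x = -x
    rw [smul_neg, show ι 1 • x = x from hx]

section Module

variable {X : Type*} [AddCommGroup X] [Module S X]

theorem mem_fixed {x : X} : x ∈ fixed ι X ↔ ι 1 • x = x := Iff.rfl

theorem map_smul_mem_fixed (r : R) (x : X) : ι r • x ∈ fixed ι X := by
  rw [mem_fixed, ← mul_smul, one_mul_map]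

/-- `R` acts on `e X` through `ι`. -/
instance : Module R (fixed ι X) where
  smul r x := ⟨ι r • (x : X), map_smul_mem_fixed ι r (x : X)⟩
  one_smul x := Subtype.ext x.2
  mul_smul r r' x := Subtype.ext (by
    change ι (r * r') • (x : X) = ι r • ι r' • (x : X)
    rw [map_mul, mul_smul])
  smul_zero r := Subtype.ext (smul_zero (ι r) : ι r • (0 : X) = 0)
  smul_add r x y := Subtype.ext (smul_add (ι r) (x : X) y)
  add_smul r r' x := Subtype.ext (by
    change ι (r + r') • (x : X) = ι r • (x : X) + ι r' • (x : X)
    rw [map_add, add_smul])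
  zero_smul x := Subtype.ext (by
    change ι 0 • (x : X) = 0
    rw [map_zero, zero_smul])

theorem coe_smul_fixed (r : R) (x : fixed ι X) : ((r • x : fixed ι X) : X) = ι r • (x : X) := rfl

/-- The restriction of an `S`-linear map `X → Y` to `e X → e Y`. -/
def mapFixed {Y : Type*} [AddCommGroup Y] [Module S Y] (f : X →ₗ[S] Y) :
    fixed ι X →ₗ[R] fixed ι Y where
  toFun x := ⟨f x, by rw [mem_fixed, ← map_smul, x.2]⟩
  map_add' x y := Subtype.ext (f.map_add x y)
  map_smul' r x := Subtype.ext (f.map_smul (ι r) x)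

/-- The projection `X → e X`. -/
def toFixed : X →+ fixed ι X where
  toFun x := ⟨ι 1 • x, map_smul_mem_fixed ι 1 x⟩
  map_zero' := Subtype.ext (smul_zero _)
  map_add' x y := Subtype.ext (smul_add _ x y)

theorem coe_toFixed (x : X) : (toFixed ι x : X) = ι 1 • x := rfl

end Module

/-- The right action of `S` on `e S`. -/
instance : Module Sᵐᵒᵖ (fixed ι S) where
  smul s x := ⟨(x : S) * s.unop, by
    rw [mem_fixed, smul_eq_mul, ← mul_assoc, ← smul_eq_mul (ι 1), x.2]⟩
  one_smul x := Subtype.ext (mul_one (x : S))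
  mul_smul s s' x := Subtype.ext (mul_assoc (x : S) s'.unop s.unop).symm
  smul_zero s := Subtype.ext (zero_mul s.unop)
  smul_add s x y := Subtype.ext (add_mul (x : S) y s.unop)
  add_smul s s' x := Subtype.ext (mul_add (x : S) s.unop s'.unop)
  zero_smul x := Subtype.ext (mul_zero (x : S))

theorem coe_op_smul_fixed (s : S) (x : fixed ι S) :
    ((MulOpposite.op s • x : fixed ι S) : S) = x * s := rfl

instance : SMulCommClass R Sᵐᵒᵖ (fixed ι S) where
  smul_comm r s x := Subtype.ext (mul_assoc (ι r) (x : S) s.unop).symm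

/-- The subgroup `S e` of `S`, where `e = ι 1`. -/
def fixedRight : AddSubgroup S where
  carrier := {x | x * ι 1 = x}
  zero_mem' := zero_mul _
  add_mem' {x y} hx hy := by
    change (x + y) * ι 1 = x + y
    rw [add_mul, show x * ι 1 = x from hx, show y * ι 1 = y from hy]
  neg_mem' {x} hx := by
    change -x * ι 1 = -x
    rw [neg_mul, show x * ι 1 = x from hx]

theorem mem_fixedRight {x : S} : x ∈ fixedRight ι ↔ x * ι 1 = x := Iff.rfl

instance : Module S (fixedRight ι) where
  smul s x := ⟨s * x, by rw [mem_fixedRight, mul_assoc, x.2]⟩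
  one_smul x := Subtype.ext (one_mul (x : S))
  mul_smul s s' x := Subtype.ext (mul_assoc s s' (x : S))
  smul_zero s := Subtype.ext (mul_zero s)
  smul_add s x y := Subtype.ext (mul_add s (x : S) y)
  add_smul s s' x := Subtype.ext (add_mul s s' (x : S))
  zero_smul x := Subtype.ext (zero_mul (x : S))

theorem coe_smul_fixedRight (s : S) (x : fixedRight ι) :
    ((s • x : fixedRight ι) : S) = s * x := rfl

instance : Module Rᵐᵒᵖ (fixedRight ι) where
  smul r x := ⟨(x : S) * ι r.unop, by rw [mem_fixedRight, mul_assoc, map_mul_one]⟩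
  one_smul x := Subtype.ext x.2
  mul_smul r r' x := Subtype.ext (by
    change (x : S) * ι (r'.unop * r.unop) = (x : S) * ι r'.unop * ι r.unop
    rw [map_mul, mul_assoc])
  smul_zero r := Subtype.ext (zero_mul (ι r.unop))
  smul_add r x y := Subtype.ext (add_mul (x : S) y (ι r.unop))
  add_smul r r' x := Subtype.ext (by
    change (x : S) * ι (r.unop + r'.unop) = (x : S) * ι r.unop + (x : S) * ι r'.unop
    rw [map_add, mul_add])
  zero_smul x := Subtype.ext (by
    change (x : S) * ι 0 = 0
    rw [map_zero, mul_zero])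

theorem coe_op_smul_fixedRight (r : R) (x : fixedRight ι) :
    ((MulOpposite.op r • x : fixedRight ι) : S) = x * ι r := rfl

instance : SMulCommClass S Rᵐᵒᵖ (fixedRight ι) where
  smul_comm s r x := Subtype.ext (mul_assoc s (x : S) (ι r.unop)).symm

/-- The `S`-module coinduced by an `R`-module `Y`: the homomorphisms `e S → Y` of `R`-modules. -/
def Coind (Y : Type*) [AddCommGroup Y] [Module R Y] : Type _ := fixed ι S →ₗ[R] Y

section Coind

variable (Y : Type*) [AddCommGroup Y] [Module R Y]

instance : AddCommGroup (Coind ι Y) := inferInstanceAs (AddCommGroup (fixed ι S →ₗ[R] Y))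

instance : FunLike (Coind ι Y) (fixed ι S) Y :=
  inferInstanceAs (FunLike (fixed ι S →ₗ[R] Y) (fixed ι S) Y)

instance : LinearMapClass (Coind ι Y) R (fixed ι S) Y :=
  inferInstanceAs (LinearMapClass (fixed ι S →ₗ[R] Y) R (fixed ι S) Y)

variable {Y}

theorem coind_ext {f f' : Coind ι Y} (h : ∀ x, f x = f' x) : f = f' := LinearMap.ext h

/-- Right multiplication by `s` on `e S`. -/
def mulRightFixed (s : S) : fixed ι S →ₗ[R] fixed ι S where
  toFun x := MulOpposite.op s • x
  map_add' x y := smul_add _ x y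
  map_smul' r x := (smul_comm r (MulOpposite.op s) x).symm

instance : Module S (Coind ι Y) where
  smul s f := LinearMap.comp (M₃ := Y) f (mulRightFixed ι s)
  one_smul f := coind_ext ι fun x => congrArg f (one_smul Sᵐᵒᵖ x)
  mul_smul s s' f := coind_ext ι fun x =>
    congrArg f (mul_smul (MulOpposite.op s') (MulOpposite.op s) x)
  smul_zero _ := rfl
  smul_add _ _ _ := rfl
  add_smul s s' f := coind_ext ι fun x =>
    (congrArg f (add_smul (MulOpposite.op s) (MulOpposite.op s') x)).trans (map_add f _ _)
  zero_smul f := coind_ext ι fun x => (congrArg f (zero_smul Sᵐᵒᵖ x)).trans (map_zero f)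

theorem coind_smul_apply (s : S) (f : Coind ι Y) (x : fixed ι S) :
    (s • f) x = f (MulOpposite.op s • x) := rfl

end Coind

end Fixed

/-! ### Full faithfulness and essential surjectivity of `X ↦ e X` -/

section Equivalence

variable {K R S : Type*} [CommRing K] [Ring R] [Ring S] [Algebra K R] [Algebra K S]
  {ι : R →ₙₐ[K] S}

/-- The left ideal spanned by `e S` is the two-sided ideal `S e S`. Fullness enters the later
arguments only through this expansion of `1`. -/
theorem exists_sum_eq_one (h : IsFullCorner ι) : 
    ∃ c : S →₀ S, c.sum (fun t s => s * (ι 1 * t)) = 1 := by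
  have h1 : (1 : S) ∈ Submodule.span S (Set.range fun t : S => ι 1 * t) := by
    have := h.full
    rw [Ideal.span] at this
    rw [this]
    trivial
  exact Finsupp.mem_span_range_iff_exists_finsupp.1 h1

theorem one_mul_one (ι : R →ₙₐ[K] S) : ι 1 * ι 1 = ι 1 := one_mul_map ι 1

section Module

variable {X Y : Type*} [AddCommGroup X] [Module S X] [AddCommGroup Y] [Module S Y]

theorem eq_sum_smul_toFixed {c : S →₀ S} (hc : c.sum (fun t s => s * (ι 1 * t)) = 1) (x : X) :
    x = c.sum fun t s => s • (toFixed ι (t • x) : X) := by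
  conv_lhs => rw [← one_smul S x, ← hc, Finsupp.sum, Finset.sum_smul]
  simp only [coe_toFixed, mul_smul, Finsupp.sum]

/-- An `S`-linear map is determined by its values on `e X`, which generates `X`. -/
theorem mapFixed_injective (h : IsFullCorner ι) :
    Function.Injective (mapFixed ι : (X →ₗ[S] Y) → _) := by
  intro f f' hf
  obtain ⟨c, hc⟩ := h.exists_sum_eq_one
  ext x
  rw [eq_sum_smul_toFixed hc x]
  simp only [Finsupp.sum, map_sum, map_smul]
  refine Finset.sum_congr rfl fun t _ => congrArg (c t • ·) ?_
  exact congrArg Subtype.val (LinearMap.congr_fun hf (toFixed ι (t • x)))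

theorem toFixed_smul_coe {r : R} {s : S} (hr : ι r = ι 1 * s * ι 1) (x : fixed ι X) :
    toFixed ι (s • (x : X)) = r • x := by
  apply Subtype.ext
  rw [coe_toFixed, coe_smul_fixed, hr, mul_smul, mul_smul, x.2]

/-- With `1 = ∑ a e t`, the only possible extension of `f` is `F x = ∑ a • f (e t x)`. Its linearity
rests on `f (e s x) = e s F x`. -/
theorem mapFixed_surjective (h : IsFullCorner ι) :
    Function.Surjective (mapFixed ι : (X →ₗ[S] Y) → _) := by
  intro f
  obtain ⟨c, hc⟩ := h.exists_sum_eq_one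
  -- On `e X`, `e s` acts as `e s e`, an element of `R`, so `f` commutes with it.
  have key (s : S) (x : fixed ι X) :
      (f (toFixed ι (s • (x : X))) : Y) = ι 1 • s • (f x : Y) := by
    obtain ⟨r, hr⟩ := h.exists_eq s
    rw [toFixed_smul_coe hr, map_smul, coe_smul_fixed, hr, mul_smul, mul_smul, (f x).2]
  have key' (s : S) (x : X) :
      (f (toFixed ι (s • x)) : Y) =
        ι 1 • s • c.sum fun t a => a • (f (toFixed ι (t • x)) : Y) := by
    conv_lhs => rw [eq_sum_smul_toFixed hc x]
    simp only [Finsupp.sum, Finset.smul_sum, map_sum, AddSubgroup.val_finsetSum]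
    refine Finset.sum_congr rfl fun t _ => ?_
    rw [← mul_smul s, key, mul_smul]
  refine ⟨{ toFun := fun x => c.sum fun t a => a • (f (toFixed ι (t • x)) : Y)
            map_add' := fun x y => ?_
            map_smul' := fun s x => ?_ }, ?_⟩
  · simp only [Finsupp.sum, smul_add, map_add, AddSubgroup.coe_add, Finset.sum_add_distrib]
  · rw [RingHom.id_apply]
    -- Expanding `s F x` by the same formula leaves the comparison of `f (e t s x)` with `e t s F
    -- x`, which is `key'`.
    conv_rhs => rw [eq_sum_smul_toFixed hc (s • c.sum fun t a => a • (f (toFixed ι (t • x)) : Y))]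
    simp only [coe_toFixed]
    refine Finset.sum_congr rfl fun t _ => congrArg (c t • ·) ?_
    rw [← mul_smul t s x, key', mul_smul]
  · ext x
    change (c.sum fun t a => a • (f (toFixed ι (t • (x : X))) : Y)) = f x
    conv_rhs => rw [eq_sum_smul_toFixed hc (f x : Y)]
    refine Finset.sum_congr rfl fun t _ => congrArg (c t • ·) ?_
    rw [key, coe_toFixed]

end Module

/-- Right multiplication by `e = ι 1`, as a map `e S → e S e = R`. -/
noncomputable def cornerProj (h : IsFullCorner ι) : fixed ι S →ₗ[R] R where
  toFun x := (h.exists_eq x).choose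
  map_add' x y := h.injective (by
    rw [map_add, (h.exists_eq _).choose_spec, (h.exists_eq _).choose_spec,
      (h.exists_eq _).choose_spec, AddSubgroup.coe_add, mul_add, add_mul])
  map_smul' r x := h.injective (by
    rw [RingHom.id_apply, smul_eq_mul, map_mul, (h.exists_eq _).choose_spec,
      (h.exists_eq _).choose_spec, coe_smul_fixed, smul_eq_mul, ← mul_assoc, one_mul_map,
      ← mul_assoc, ← mul_assoc, map_mul_one])

theorem map_cornerProj (h : IsFullCorner ι) (x : fixed ι S) :
    ι (h.cornerProj x) = x * ι 1 := by
  refine (h.exists_eq x).choose_spec.trans ?_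
  rw [← smul_eq_mul (ι 1) (x : S), x.2]

/-- `e` as an element of `e S`. -/
def oneFixed (ι : R →ₙₐ[K] S) : fixed ι S := ⟨ι 1, one_mul_one ι⟩

theorem cornerProj_smul_oneFixed (h : IsFullCorner ι) (x : fixed ι S) :
    h.cornerProj x • oneFixed ι = MulOpposite.op (ι 1) • x :=
  Subtype.ext (by
    rw [coe_smul_fixed, coe_op_smul_fixed, map_cornerProj, oneFixed, smul_eq_mul, mul_assoc,
      one_mul_one])

theorem cornerProj_oneFixed (h : IsFullCorner ι) : h.cornerProj (oneFixed ι) = 1 :=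
  h.injective (by rw [map_cornerProj, oneFixed, one_mul_one])

/-- Evaluation at `e`, from `e (Coind Y)` to `Y`. -/
def evalOne (ι : R →ₙₐ[K] S) (Y : Type*) [AddCommGroup Y] [Module R Y] :
    fixed ι (Coind ι Y) →ₗ[R] Y where
  toFun f := (f : Coind ι Y) (oneFixed ι)
  map_add' _ _ := rfl
  map_smul' r f := by
    rw [coe_smul_fixed, coind_smul_apply, RingHom.id_apply, ← map_smul]
    refine congrArg (f : Coind ι Y) (Subtype.ext ?_)
    rw [coe_op_smul_fixed, coe_smul_fixed, oneFixed, smul_eq_mul, one_mul_map, map_mul_one]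

/-- If `f = e f`, then `f x = f (x e) = (x e) • f e`, as `x e` lies in `e S e = R`; so `f e`
determines `f`. Conversely, `x ↦ (x e) • y` is fixed by `e` and takes `e` to `y`. -/
theorem evalOne_bijective (h : IsFullCorner ι) (Y : Type*) [AddCommGroup Y] [Module R Y] :
    Function.Bijective (evalOne ι Y) := by
  refine ⟨(injective_iff_map_eq_zero _).2 fun f hf =>
    Subtype.ext (coind_ext ι fun x => ?_), fun y => ?_⟩
  · replace hf : (f : Coind ι Y) (oneFixed ι) = 0 := hf
    rw [← f.2, coind_smul_apply, ← h.cornerProj_smul_oneFixed, map_smul, hf, smul_zero]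
    rfl
  · let f : Coind ι Y := (LinearMap.toSpanSingleton R Y y).comp h.cornerProj
    have hf : f ∈ fixed ι (Coind ι Y) := coind_ext ι fun x => by
      change h.cornerProj (MulOpposite.op (ι 1) • x) • y = h.cornerProj x • y
      congr 1
      apply h.injective
      rw [map_cornerProj, map_cornerProj, coe_op_smul_fixed, mul_assoc, one_mul_one]
    refine ⟨⟨f, hf⟩, ?_⟩
    change h.cornerProj (oneFixed ι) • y = y
    rw [cornerProj_oneFixed, one_smul]

end Equivalence

/-! ### The `K`-linear equivalence of module categories -/

section Category

open CategoryTheory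
open scoped ModuleCat.Algebra

variable {K : Type*} {R : Type u₁} {S : Type u₂} [CommRing K] [Ring R] [Ring S] [Algebra K R]
  [Algebra K S]

/-- The functor `X ↦ e X` from `S`-modules to `R`-modules. -/
def fixedFunctor (ι : R →ₙₐ[K] S) : ModuleCat.{w} S ⥤ ModuleCat.{w} R where
  obj X := ModuleCat.of R (fixed ι X)
  map f := ModuleCat.ofHom (mapFixed ι f.hom)
  map_id _ := rfl
  map_comp _ _ := rfl

variable {ι : R →ₙₐ[K] S}

theorem fixedFunctor_isEquivalence (h : IsFullCorner ι) :
    (fixedFunctor.{max u₁ u₂} ι).IsEquivalence where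
  faithful := ⟨fun {X Y f f'} hf => ModuleCat.hom_ext (h.mapFixed_injective
    (congrArg ModuleCat.Hom.hom hf))⟩
  full := ⟨fun {X Y} f => by
    obtain ⟨f', hf'⟩ := h.mapFixed_surjective (X := X) (Y := Y) f.hom
    exact ⟨ModuleCat.ofHom f', ModuleCat.hom_ext hf'⟩⟩
  essSurj := ⟨fun Y => ⟨ModuleCat.of S (Coind ι Y),
    ⟨(LinearEquiv.ofBijective _ (h.evalOne_bijective Y)).toModuleIso⟩⟩⟩

/-- A scalar `c` acts on `X` through `c 1_S` and on `e X` through `c e`; these agree on vectors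
fixed by `e`. -/
theorem fixedFunctor_linear (ι : R →ₙₐ[K] S) [(fixedFunctor.{w} ι).Additive] :
    (fixedFunctor.{w} ι).Linear K where
  map_smul {X Y} f c := by
    refine ModuleCat.hom_ext (LinearMap.ext fun (x : fixed ι X) => Subtype.ext ?_)
    change algebraMap K S c • (f.hom (x : X)) = ι (algebraMap K R c) • f.hom (x : X)
    rw [Algebra.algebraMap_eq_smul_one c, Algebra.algebraMap_eq_smul_one c, map_smul,
      smul_assoc, smul_assoc, one_smul, ← map_smul f.hom, x.2]

/-- An algebra is Morita equivalent to its corner at a full idempotent. -/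
theorem isMoritaEquivalent (h : IsFullCorner ι) : IsMoritaEquivalent K R S :=
  haveI := h.fixedFunctor_isEquivalence
  haveI : (fixedFunctor.{max u₁ u₂} ι).Additive := ⟨rfl⟩
  .symm K ⟨⟨{ eqv := (fixedFunctor.{max u₁ u₂} ι).asEquivalence
              linear := fixedFunctor_linear.{max u₁ u₂} ι }⟩⟩

end Category

end IsFullCorner

/-! ### Additive maps out of the balanced tensor product -/

namespace BalancedTensor

variable {R M M' P : Type*} [Ring R] [AddCommGroup M] [AddCommGroup M'] [Module Rᵐᵒᵖ M]
  [Module R M'] [AddCommGroup P]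

/-- The additive map on the tensor product induced by a balanced biadditive map. -/
noncomputable def lift (f : M →+ M' →+ P)
    (hf : ∀ m (r : R) m', f (MulOpposite.op r • m) m' = f m (r • m')) :
    BalancedTensor R M M' →+ P :=
  QuotientAddGroup.lift _ (TensorProduct.liftAddHom f fun z m m' => by
      rw [map_zsmul, AddMonoidHom.smul_apply, map_zsmul])
    ((AddSubgroup.closure_le _).2 (by
      rintro _ ⟨m, r, m', rfl⟩
      change _ = _
      rw [map_sub, TensorProduct.liftAddHom_tmul, TensorProduct.liftAddHom_tmul, hf, sub_self]))

theorem lift_tmul (f : M →+ M' →+ P)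
    (hf : ∀ m (r : R) m', f (MulOpposite.op r • m) m' = f m (r • m')) (m : M) (m' : M') :
    lift f hf (tmul R m m') = f m m' := rfl

end BalancedTensor

/-! ### The Morita context of a full corner -/

namespace IsFullCorner

variable {K : Type*} {R : Type u₁} {S : Type u₂} [CommRing K] [Ring R] [Ring S] [Algebra K R]
  [Algebra K S] {ι : R →ₙₐ[K] S}

theorem exists_map_eq_mul (h : IsFullCorner ι) (x : fixed ι S) (y : fixedRight ι) :
    ∃ r : R, ι r = (x : S) * y := by
  obtain ⟨r, hr⟩ := h.exists_eq ((x : S) * y)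
  refine ⟨r, hr.trans ?_⟩
  rw [← mul_assoc, ← smul_eq_mul (ι 1), x.2, mul_assoc, y.2]

/-- The element of `R` corresponding to the product in `S` of elements of `e S` and `S e`. -/
noncomputable def cornerMul (h : IsFullCorner ι) : fixed ι S →+ fixedRight ι →+ R :=
  AddMonoidHom.mk' (fun x => AddMonoidHom.mk' (fun y => (h.exists_map_eq_mul x y).choose)
    fun y y' => h.injective (by
      rw [map_add, (h.exists_map_eq_mul _ _).choose_spec, (h.exists_map_eq_mul _ _).choose_spec,
        (h.exists_map_eq_mul _ _).choose_spec, AddSubgroup.coe_add, mul_add]))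
    fun x x' => AddMonoidHom.ext fun y => h.injective (by
      change ι (h.exists_map_eq_mul _ _).choose =
        ι ((h.exists_map_eq_mul _ _).choose + (h.exists_map_eq_mul _ _).choose)
      rw [map_add, (h.exists_map_eq_mul _ _).choose_spec, (h.exists_map_eq_mul _ _).choose_spec,
        (h.exists_map_eq_mul _ _).choose_spec, AddSubgroup.coe_add, add_mul])

theorem map_cornerMul (h : IsFullCorner ι) (x : fixed ι S) (y : fixedRight ι) :
    ι (h.cornerMul x y) = (x : S) * y := (h.exists_map_eq_mul x y).choose_spec

/-- The product `S e × e S → S`. -/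
def ambientMul (ι : R →ₙₐ[K] S) : fixedRight ι →+ fixed ι S →+ S :=
  (AddMonoidHom.mul.compl₂ (fixed ι S).subtype).comp (fixedRight ι).subtype

theorem ambientMul_apply (y : fixedRight ι) (x : fixed ι S) :
    ambientMul ι y x = (y : S) * x := rfl

/-- The Morita context `(R, S, e S, S e)` of a full corner `R = e S e`. -/
noncomputable def moritaContext (h : IsFullCorner ι) : MoritaContext.{u₂, u₂, u₁, u₂} R S where
  M := fixed ι S
  M' := fixedRight ι
  τ := BalancedTensor.lift h.cornerMul fun x s y => h.injective (by
    rw [map_cornerMul, map_cornerMul, coe_op_smul_fixed, coe_smul_fixedRight, mul_assoc])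
  τ' := BalancedTensor.lift (ambientMul ι) fun y r x => by
    rw [ambientMul_apply, ambientMul_apply, coe_op_smul_fixedRight, coe_smul_fixed, smul_eq_mul,
      mul_assoc]
  τ_left r x y := h.injective (by
    rw [map_mul, BalancedTensor.lift_tmul, BalancedTensor.lift_tmul, map_cornerMul, map_cornerMul,
      coe_smul_fixed, smul_eq_mul, mul_assoc])
  τ_right r x y := h.injective (by
    rw [map_mul, BalancedTensor.lift_tmul, BalancedTensor.lift_tmul, map_cornerMul, map_cornerMul,
      coe_op_smul_fixedRight, mul_assoc])
  τ'_left s y x := mul_assoc s (y : S) x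
  τ'_right s y x := (mul_assoc (y : S) x s).symm
  τ_smul x y x' := Subtype.ext (by
    rw [BalancedTensor.lift_tmul, BalancedTensor.lift_tmul, coe_smul_fixed, coe_op_smul_fixed,
      map_cornerMul, ambientMul_apply, smul_eq_mul, mul_assoc])
  τ'_smul y x y' := Subtype.ext (by
    rw [BalancedTensor.lift_tmul, BalancedTensor.lift_tmul, coe_smul_fixedRight,
      coe_op_smul_fixedRight, map_cornerMul, ambientMul_apply, mul_assoc])

theorem moritaContext_τ_surjective (h : IsFullCorner ι) :
    Function.Surjective h.moritaContext.τ := fun r =>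
  ⟨.tmul S (oneFixed ι) ⟨ι r, map_mul_one ι r⟩, h.injective
    ((h.map_cornerMul _ _).trans (one_mul_map ι r))⟩

theorem moritaContext_τ'_surjective (h : IsFullCorner ι) :
    Function.Surjective h.moritaContext.τ' := by
  intro s
  obtain ⟨c, hc⟩ := h.exists_sum_eq_one
  -- From `1 = ∑ a e t` and `e = e e` one gets `s = ∑ (s a e) (e t)`.
  refine ⟨c.sum fun t a => .tmul R (⟨s * a * ι 1, by
    rw [mem_fixedRight, mul_assoc, one_mul_one]⟩ : fixedRight ι) (toFixed ι t), ?_⟩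
  rw [Finsupp.sum, map_sum]
  conv_rhs => rw [← mul_one s, ← hc, Finsupp.sum, Finset.mul_sum]
  refine Finset.sum_congr rfl fun t _ => ?_
  change s * c t * ι 1 * (ι 1 * t) = _
  rw [mul_assoc, ← mul_assoc (ι 1), one_mul_one, mul_assoc]

end IsFullCorner

/-! ### The partial skew group ring as a full corner of the global one -/

namespace AlgPartialAction

variable {K G A B : Type*} [Field K] [Group G] [Ring A] [Algebra K A] [Ring B] [Algebra K B]
  [MulSemiringAction G B] {α : AlgPartialAction K G A} {φ : A →ₙₐ[K] B}

namespace IsEnveloping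

theorem mem_range_iff_mul (h : α.IsEnveloping φ) {b : B} : b ∈ Set.range φ ↔ b * φ 1 = b := by
  refine ⟨?_, fun hb => hb ▸ h.mul_mem_left b 1⟩
  rintro ⟨a, rfl⟩
  rw [← _root_.map_mul, mul_one]

theorem mem_range_iff_one_mul (h : α.IsEnveloping φ) {b : B} :
    b ∈ Set.range φ ↔ φ 1 * b = b := by
  refine ⟨?_, fun hb => hb ▸ h.mul_mem_right 1 b⟩
  rintro ⟨a, rfl⟩
  rw [← _root_.map_mul, one_mul]

theorem mem_smul_range_iff (h : α.IsEnveloping φ) {g : G} {b : B} :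
    b ∈ (fun b : B => g • b) '' Set.range φ ↔ b * g • φ 1 = b := by
  constructor
  · rintro ⟨_, ⟨a, rfl⟩, rfl⟩
    change g • φ a * g • φ 1 = g • φ a
    rw [← smul_mul', ← _root_.map_mul, mul_one]
  · intro hb
    refine ⟨g⁻¹ • b, h.mem_range_iff_mul.2 ?_, smul_inv_smul g b⟩
    conv_rhs => rw [← hb, smul_mul', inv_smul_smul]

/-- The inclusion of `A ⋊_α G` into `B ⋊_β G`, as a homomorphism of algebras, not necessarily
unital. -/
noncomputable def toGlobalHom [SMulCommClass G K B] (h : α.IsEnveloping φ) :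
    haveI : α.IsAssociative := h.isAssociative
    α.SkewGroupRing →ₙₐ[K] SkewMonoidAlgebra B G :=
  haveI : α.IsAssociative := h.isAssociative
  { toFun := α.toGlobal φ
    map_smul' := (α.toGlobal φ).map_smul
    map_zero' := (α.toGlobal φ).map_zero
    map_add' := (α.toGlobal φ).map_add
    map_mul' := h.toGlobal_mul }

theorem toGlobal_one (α : AlgPartialAction K G A) (φ : A →ₙₐ[K] B) :
    α.toGlobal φ 1 = SkewMonoidAlgebra.single 1 (φ 1) := by
  rw [one_eq, toGlobal_δ]

theorem exists_toGlobal_eq (h : α.IsEnveloping φ) (s : SkewMonoidAlgebra B G) :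
    ∃ r, α.toGlobal φ r = α.toGlobal φ 1 * s * α.toGlobal φ 1 := by
  induction s using SkewMonoidAlgebra.induction_on with
  | zero => exact ⟨0, by rw [_root_.map_zero, mul_zero, zero_mul]⟩
  | add x y hx hy =>
    obtain ⟨r, hr⟩ := hx
    obtain ⟨r', hr'⟩ := hy
    exact ⟨r + r', by rw [_root_.map_add, hr, hr', mul_add, add_mul]⟩
  | single g b =>
    -- This is the coefficient of `e (b δ_g) e`.
    have hb : φ 1 * b * g • φ 1 ∈ φ '' (α.D g : Set A) := by
      rw [h.image_D g]
      refine ⟨h.mem_range_iff_one_mul.2 ?_, h.mem_smul_range_iff.2 ?_⟩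
      · rw [← mul_assoc, ← mul_assoc, ← _root_.map_mul, mul_one]
      · rw [mul_assoc, ← smul_mul', ← _root_.map_mul, mul_one]
    obtain ⟨a, ha, hab⟩ := hb
    refine ⟨α.δ g ⟨a, ha⟩, ?_⟩
    rw [toGlobal_δ, toGlobal_one, SkewMonoidAlgebra.single_mul_single,
      SkewMonoidAlgebra.single_mul_single, one_mul, mul_one, one_smul, hab]

theorem span_toGlobal_one_mul [SMulCommClass G K B] (h : α.IsEnveloping φ) :
    Ideal.span (Set.range fun t => α.toGlobal φ 1 * t) = (⊤ : Ideal (SkewMonoidAlgebra B G)) := by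
  set I : Ideal (SkewMonoidAlgebra B G) := Ideal.span (Set.range fun t => α.toGlobal φ 1 * t)
  have key : ∀ b ∈ NonUnitalAlgebra.adjoin K (⋃ g : G, (fun b : B => g • b) '' Set.range φ),
      SkewMonoidAlgebra.single (1 : G) b ∈ I := by
    intro b hb
    induction hb using NonUnitalAlgebra.adjoin_induction with
    | mem b hb =>
      obtain ⟨g, _, ⟨a, rfl⟩, rfl⟩ := Set.mem_iUnion.1 hb
      -- The identity `β_g(φ(a)) δ_1 = δ_g e (φ(a) δ_{g⁻¹})` exhibits the generator as an element of
      -- `S e S`.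
      have h1 : SkewMonoidAlgebra.single (1 : G) (g • φ a) = SkewMonoidAlgebra.single g (1 : B) *
          (α.toGlobal φ 1 * SkewMonoidAlgebra.single g⁻¹ (φ a)) := by
        rw [toGlobal_one, SkewMonoidAlgebra.single_mul_single, SkewMonoidAlgebra.single_mul_single,
          one_smul, ← _root_.map_mul, one_mul, one_mul, one_mul, mul_inv_cancel]
      change SkewMonoidAlgebra.single (1 : G) (g • φ a) ∈ I
      rw [h1]
      exact I.mul_mem_left _ (Ideal.subset_span ⟨_, rfl⟩)
    | add x y _ _ hx hy =>
      rw [SkewMonoidAlgebra.single_add]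
      exact I.add_mem hx hy
    | zero =>
      rw [SkewMonoidAlgebra.single_zero]
      exact I.zero_mem
    | mul x y _ _ _ hy =>
      have h1 : SkewMonoidAlgebra.single (1 : G) (x * y) =
          SkewMonoidAlgebra.single (1 : G) x * SkewMonoidAlgebra.single (1 : G) y := by
        rw [SkewMonoidAlgebra.single_mul_single, one_smul, one_mul]
      rw [h1]
      exact I.mul_mem_left _ hy
    | smul c x _ hx =>
      rw [← SkewMonoidAlgebra.smul_single]
      exact Submodule.smul_of_tower_mem I c hx
  rw [Ideal.eq_top_iff_one, SkewMonoidAlgebra.one_def]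
  -- `B` has a unity, which therefore lies in the non-unital algebra generated by the translates of
  -- `φ(A)`.
  exact key 1 (by rw [h.generates]; trivial)

theorem isFullCorner [SMulCommClass G K B] (h : α.IsEnveloping φ) :
    haveI : α.IsAssociative := h.isAssociative
    IsFullCorner h.toGlobalHom :=
  haveI : α.IsAssociative := h.isAssociative
  { injective := h.toGlobal_injective
    exists_eq := h.exists_toGlobal_eq
    full := h.span_toGlobal_one_mul }

theorem mem_envM_iff (h : α.IsEnveloping φ) {x : SkewMonoidAlgebra B G} :
    x ∈ envM G φ ↔ α.toGlobal φ 1 * x = x := by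
  rw [SkewMonoidAlgebra.ext_iff]
  refine forall_congr' fun g => ?_
  rw [h.mem_range_iff_one_mul, toGlobal_one, SkewMonoidAlgebra.coeff_single_one_mul]

/-- Right multiplication by `e` moves `φ(1_A)` past `δ_g`: the coefficient at `g` is multiplied by
`β_g(φ(1_A))`, the identity of `β_g(φ(A))`. -/
theorem mem_envN_iff [SMulCommClass G K B] (h : α.IsEnveloping φ) {x : SkewMonoidAlgebra B G} :
    x ∈ envN G φ ↔ x * α.toGlobal φ 1 = x := by
  rw [SkewMonoidAlgebra.ext_iff]
  refine forall_congr' fun g => ?_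
  rw [h.mem_smul_range_iff, toGlobal_one, SkewMonoidAlgebra.coeff_mul_single_one]

end IsEnveloping

end AlgPartialAction

theorem mainTheorem5 {K : Type u₁} {G : Type u} {A : Type v} {B : Type w} [Field K] [Group G]
    [Ring A] [Algebra K A] [Ring B] [Algebra K B] [MulSemiringAction G B] [SMulCommClass G K B]
    (α : AlgPartialAction K G A) (φ : A →ₙₐ[K] B) (h : α.IsEnveloping φ) :
    haveI : α.IsAssociative := h.isAssociative
    IsMoritaEquivalent K α.SkewGroupRing (SkewMonoidAlgebra B G) ∧
    ∃ (C : MoritaContext.{max u w, max u w, max u v, max u w}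
        α.SkewGroupRing (SkewMonoidAlgebra B G))
      (i : C.M ≃+ AlgPartialAction.envM G φ) (j : C.M' ≃+ AlgPartialAction.envN G φ),
      (∀ (r : α.SkewGroupRing) (x : C.M),
        (i (r • x) : SkewMonoidAlgebra B G) = α.toGlobal φ r * i x) ∧
      (∀ (s : SkewMonoidAlgebra B G) (x : C.M),
        (i (MulOpposite.op s • x) : SkewMonoidAlgebra B G) = i x * s) ∧
      (∀ (s : SkewMonoidAlgebra B G) (y : C.M'),
        (j (s • y) : SkewMonoidAlgebra B G) = s * j y) ∧
      (∀ (r : α.SkewGroupRing) (y : C.M'),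
        (j (MulOpposite.op r • y) : SkewMonoidAlgebra B G) = j y * α.toGlobal φ r) ∧
      (∀ (x : C.M) (y : C.M'),
        α.toGlobal φ (C.τ (.tmul (SkewMonoidAlgebra B G) x y)) = i x * j y) ∧
      (∀ (y : C.M') (x : C.M), C.τ' (.tmul α.SkewGroupRing y x) = j y * i x) ∧
      Function.Surjective C.τ ∧ Function.Surjective C.τ' := by
  have : α.IsAssociative := h.isAssociative
  have hc := h.isFullCorner
  refine ⟨hc.isMoritaEquivalent, hc.moritaContext,
    -- Both identifications are the identity on underlying elements of `B ⋊_β G`, so compatibility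
    -- with the actions is definitional.
    { Equiv.subtypeEquivRight fun _ => h.mem_envM_iff.symm with map_add' := fun _ _ => rfl },
    { Equiv.subtypeEquivRight fun _ => h.mem_envN_iff.symm with map_add' := fun _ _ => rfl },
    fun _ _ => rfl, fun _ _ => rfl, fun _ _ => rfl, fun _ _ => rfl, hc.map_cornerMul,
    fun _ _ => rfl, hc.moritaContext_τ_surjective, hc.moritaContext_τ'_surjective⟩
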